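/- Let $q$ be a prime power, $r\ge 2$ an integer, and let $M$ be the $2r\times 2r$ block diagonal matrix over $\mathbb{F}_q$ whose $r$ diagonal blocks are all equal to $\begin{bmatrix}0&-1\\1&0\end{bmatrix}$. The symplectic graph $Sp(2r,q)$ has as vertices the $1$-dimensional subspaces $[x]$ of $\mathbb{F}_q^{2r}$ (where $[x]$ is the span of the nonzero vector $x$), with $[x]\sim[y]$ if and only if $x^{t}My\ne 0$. For a connected graph $G$, let $\kappa_2(G)$ be the minimum size of a set $S$ of vertices such that $G\setminus S$ is disconnected and none of its connected components is a single vertex. For a set $X$ of vertices let $N(X)$ be the set of vertices outside $X$ that are adjacent to some vertex of $X$. The graph $Sp(2r,q)$ is connected and strongly regular with parameters $v=\frac{q^{2r}-1}{q-1}$, $k=q^{2r-1}$, $\lambda=\mu=q^{2r-2}(q-1)$, and $$\kappa_2(Sp(2r,q))=q^{2r-1}+q^{2r-2}-q-1=(2k-\lambda-2)-(q-1),$$ which is smaller by $q-1$ than the value $2k-\lambda-2$ conjectured by Brouwer. Moreover, the sets $S$ of exactly this size such that $Sp(2r,q)\setminus S$ is disconnected without single-vertex components are precisely the neighbourhoods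 of hyperbolic lines, that is, the sets $$N(\{[u],[v],[u+x_1v],\dots,[u+x_{q-1}v]\}),$$ where $[u]$ and $[v]$ are adjacent vertices and $\mathbb{F}_q\setminus\{0\}=\{x_1,\dots,x_{q-1}\}$. Consequently, the difference between $2k-\lambda-2$ and $\kappa_2(G)$ is unbounded over connected strongly regular graphs $G$: for every $r\ge2$ and every $N$ there is a prime $p$ such that for $G=Sp(2r,p)$ this difference is at least $N$. -/

import Mathlib

open scoped Matrix

namespace SymplecticSRG

section Graph

variable {V : Type*} (G : SimpleGraph V)

/-- The neighbourhood `N(X)` of a set of vertices: the vertices outside `X` that are adjacent to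
some vertex of `X`. -/
def neighborhood (X : Set V) : Set V :=
  {y | y ∉ X ∧ ∃ x ∈ X, G.Adj x y}

/-- `S` is a disconnecting set of `G`: removing `S` leaves a graph with at least two connected
components. -/
def IsDisconnecting (S : Set V) : Prop :=
  ¬ (G.induce Sᶜ).Preconnected

/-- `S` is a disconnecting set of `G` whose removal leaves only non-singleton components. -/
def IsNonsingletonDisconnecting (S : Set V) : Prop :=
  IsDisconnecting G S ∧ ∀ c : (G.induce Sᶜ).ConnectedComponent, c.supp.Nontrivial

/-- `κ₂(G)`: the minimum size of a disconnecting set of `G` whose removal leaves only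
non-singleton components (`⊤` if there is no such set). -/
noncomputable def kappa2 : ℕ∞ :=
  ⨅ S ∈ {S : Set V | IsNonsingletonDisconnecting G S}, S.encard

end Graph

section Symplectic

variable (F : Type*) [Field F] (r : ℕ)

/-- The block diagonal `2r × 2r` matrix with `r` diagonal blocks `[0, -1; 1, 0]`. The index
`(i, j)` is the `i`-th coordinate of the `j`-th block. -/
def formMatrix : Matrix (Fin 2 × Fin r) (Fin 2 × Fin r) F :=
  Matrix.blockDiagonal fun _ : Fin r => !![0, -1; 1, 0]

variable {F r}

/-- The symplectic form `f(x, y) = xᵗ M y` on `F^{2r}`. -/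
def form (x y : Fin 2 × Fin r → F) : F :=
  x ⬝ᵥ (formMatrix F r *ᵥ y)

theorem form_eq_sum (x y : Fin 2 × Fin r → F) :
    form x y = ∑ j : Fin r, (x (1, j) * y (0, j) - x (0, j) * y (1, j)) := by
  simp only [form, formMatrix, dotProduct, Matrix.mulVec, Matrix.blockDiagonal_apply,
    Fintype.sum_prod_type, Fin.sum_univ_two, ite_mul, zero_mul, Finset.sum_ite_eq,
    Finset.mem_univ, if_true, ← Finset.sum_add_distrib]
  refine Finset.sum_congr rfl fun j _ => ?_
  simp
  ring

theorem form_self (x : Fin 2 × Fin r → F) : form x x = 0 := by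
  rw [form_eq_sum]
  exact Finset.sum_eq_zero fun j _ => by ring

theorem form_swap (x y : Fin 2 × Fin r → F) : form x y = -form y x := by
  rw [form_eq_sum, form_eq_sum, ← Finset.sum_neg_distrib]
  exact Finset.sum_congr rfl fun j _ => by ring

theorem form_smul_smul (a b : F) (x y : Fin 2 × Fin r → F) :
    form (a • x) (b • y) = a * b * form x y := by
  rw [form_eq_sum, form_eq_sum, Finset.mul_sum]
  refine Finset.sum_congr rfl fun j _ => ?_
  simp only [Pi.smul_apply, smul_eq_mul]
  ring

variable (F r)

/-- The vertices of the symplectic graph: the one-dimensional subspaces `[x]` of `F^{2r}`. -/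
abbrev Vertex : Type _ := Projectivization F (Fin 2 × Fin r → F)

/-- The symplectic graph `Sp(2r, q)` over `F`: `[x]` and `[y]` are adjacent if and only if
`xᵗ M y ≠ 0`. By `symplecticGraph_adj_mk` below this does not depend on the representatives. -/
def symplecticGraph : SimpleGraph (Vertex F r) where
  Adj p q := form p.rep q.rep ≠ 0
  symm := ⟨fun p q h => by rw [form_swap]; exact neg_ne_zero.mpr h⟩
  loopless := ⟨fun p h => h (form_self p.rep)⟩

variable {F r}

theorem symplecticGraph_adj_mk {x y : Fin 2 × Fin r → F} (hx : x ≠ 0) (hy : y ≠ 0) :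
    (symplecticGraph F r).Adj (Projectivization.mk F x hx) (Projectivization.mk F y hy) ↔
      form x y ≠ 0 := by
  obtain ⟨a, ha⟩ := Projectivization.exists_smul_eq_mk_rep F x hx
  obtain ⟨b, hb⟩ := Projectivization.exists_smul_eq_mk_rep F y hy
  change form _ _ ≠ 0 ↔ _
  rw [← ha, ← hb, Units.smul_def, Units.smul_def, form_smul_smul]
  simp

/-- The set `{[u], [v], [u + x₁ v], …, [u + x_{q-1} v]}`, where `x₁, …, x_{q-1}` are the nonzero
elements of `F`; it is a hyperbolic line when `[u]` and `[v]` are adjacent. (In that case `u` and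
`v` are linearly independent, so each `u + x v` is nonzero.) -/
def hyperbolicLine (u v : Fin 2 × Fin r → F) (hu : u ≠ 0) (hv : v ≠ 0) : Set (Vertex F r) :=
  {Projectivization.mk F u hu, Projectivization.mk F v hv} ∪
    {p | ∃ (x : F) (_ : x ≠ 0) (h : u + x • v ≠ 0), p = Projectivization.mk F (u + x • v) h}

noncomputable instance [Finite F] : Fintype (Vertex F r) :=
  Fintype.ofFinite _

noncomputable instance : DecidableEq (Vertex F r) :=
  Classical.decEq _

noncomputable instance : DecidableRel (symplecticGraph F r).Adj :=
  Classical.decRel _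

end Symplectic

end SymplecticSRG

/-! Non-adjacency is orthogonality for a nondegenerate alternating form. If removing `S` leaves
parts `A` and `B` with no edges between them, then `A` lies in the points of `U`, the span of `A`,
and `B` in the points of `U⊥` (`exists_subset_points_perp`). Without isolated vertices each part
contains an edge, so `U` and `U⊥` both have dimension at least 2, and the dimensions sum to `2r`.
Under this constraint the total number of points of the two subspaces is largest only when one of
them is a plane (`geomSum_convex`), which bounds `|S|` from below
(`IsNonsingletonDisconnecting.le_ncard`).

Equality forces `A` and `B` to be all the points of `U` and `U⊥`. The plane among the two contains
an edge, so its points form a hyperbolic line and `S` is the neighbourhood of that line. Conversely,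
such a plane is nondegenerate, as is its complement, so neither part has isolated vertices
(`neighborhood_hyperbolicLine_spec`). -/

namespace SymplecticSRG

/-! ### Disconnecting sets as partitions without crossing edges. -/

section Graph

variable {V : Type*} {G : SimpleGraph V}

/-- A set closed under adjacency in a preconnected graph is everything once it is nonempty. -/
theorem mem_of_preconnected {A : Set V} (hG : G.Preconnected)
    (hA : ∀ x ∈ A, ∀ y, G.Adj x y → y ∈ A) {x : V} (hx : x ∈ A) (y : V) : y ∈ A := by
  obtain ⟨w⟩ := hG x y
  induction w with
  | nil => exact hx
  | cons h _ ih => exact ih (hA _ hx _ h)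

/-- `S` disconnects `G` without leaving singletons iff no vertex outside `S` is isolated and the
vertices outside `S` split into two nonempty parts with no edges between them. -/
theorem isNonsingletonDisconnecting_iff {S : Set V} :
    IsNonsingletonDisconnecting G S ↔
      (∀ x ∉ S, ∃ y ∉ S, G.Adj x y) ∧
        ∃ A B : Set V, A ∪ B = Sᶜ ∧ Disjoint A B ∧ A.Nonempty ∧ B.Nonempty ∧
          ∀ x ∈ A, ∀ y ∈ B, ¬ G.Adj x y := by
  constructor
  · rintro ⟨hdis, hcomp⟩
    refine ⟨fun x hx => ?_, ?_⟩
    · let x' : ↥Sᶜ := ⟨x, hx⟩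
      -- The first step of a walk from `x` to another vertex of its component gives the required
      -- neighbour.
      obtain ⟨y, hy, hyx⟩ :=
        (hcomp ((G.induce Sᶜ).connectedComponentMk x')).exists_ne x'
      have hr : (G.induce Sᶜ).Reachable x' y :=
        (SimpleGraph.ConnectedComponent.exact hy).symm
      obtain ⟨w⟩ := hr
      cases w with
      | nil => exact absurd rfl hyx
      | @cons _ z _ h _ => exact ⟨z, z.2, h⟩
    · simp only [IsDisconnecting, SimpleGraph.Preconnected, not_forall] at hdis
      obtain ⟨x, y, hxy⟩ := hdis
      refine ⟨Subtype.val '' {z | (G.induce Sᶜ).Reachable x z},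
        Subtype.val '' {z | ¬ (G.induce Sᶜ).Reachable x z}, ?_, ?_, ?_, ?_, ?_⟩
      · rw [← Set.image_union]
        ext z
        simp only [Set.mem_image, Set.mem_union]
        exact ⟨fun ⟨z', _, h⟩ => h ▸ z'.2, fun hz => ⟨⟨z, hz⟩, em _, rfl⟩⟩
      · rw [Set.disjoint_image_iff Subtype.val_injective, Set.disjoint_left]
        exact fun z hz hz' => hz' hz
      · exact ⟨x, x, SimpleGraph.Reachable.refl x, rfl⟩
      · exact ⟨y, y, hxy, rfl⟩
      · rintro _ ⟨a, ha, rfl⟩ _ ⟨b, hb, rfl⟩ hab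
        have : (G.induce Sᶜ).Adj a b := hab
        exact hb (SimpleGraph.Reachable.trans ha this.reachable)
  · rintro ⟨hiso, A, B, hAB, hdisj, ⟨a, ha⟩, ⟨b, hb⟩, hno⟩
    have hsub : ∀ x : ↥Sᶜ, (x : V) ∈ A ∨ (x : V) ∈ B := fun x => hAB.ge x.2
    refine ⟨fun hpre => ?_, fun c => ?_⟩
    · have haS : a ∈ Sᶜ := hAB ▸ Or.inl ha
      have hbS : b ∈ Sᶜ := hAB ▸ Or.inr hb
      have := mem_of_preconnected (A := {x : ↥Sᶜ | (x : V) ∈ A}) hpre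
        (fun x hx y hxy => (hsub y).resolve_right fun hy => hno _ hx _ hy hxy)
        (x := ⟨a, haS⟩) ha ⟨b, hbS⟩
      exact Set.disjoint_left.mp hdisj this hb
    · induction c using SimpleGraph.ConnectedComponent.ind with
      | h x =>
        obtain ⟨y, hy, hxy⟩ := hiso x x.2
        have hadj : (G.induce Sᶜ).Adj x ⟨y, hy⟩ := hxy
        exact ⟨x, rfl, ⟨y, hy⟩,
          SimpleGraph.ConnectedComponent.sound hadj.reachable.symm, hadj.ne⟩

end Graph

/-! ### Numbers of points of projective spaces. -/

section GeomSum

/-- The number of points of a projective space of vector space dimension `m` over `𝔽_q`. -/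
def geomSum (q m : ℕ) : ℕ := ∑ i ∈ Finset.range m, q ^ i

theorem geomSum_add (q m n : ℕ) : geomSum q (m + n) = geomSum q m + q ^ m * geomSum q n := by
  simp only [geomSum, Finset.sum_range_add, Finset.mul_sum, pow_add]

theorem geomSum_succ (q m : ℕ) : geomSum q (m + 1) = geomSum q m + q ^ m :=
  Finset.sum_range_succ _ _

theorem geomSum_mono (q : ℕ) : Monotone (geomSum q) :=
  monotone_nat_of_le_succ fun m => by rw [geomSum_succ]; omega

theorem geomSum_eq_div {q : ℕ} (hq : 2 ≤ q) (m : ℕ) : geomSum q m = (q ^ m - 1) / (q - 1) :=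
  Nat.geomSum_eq hq m

/-- The right side exceeds the left by `(q ^ n - q ^ 2) * geomSum q (m - 2)`, which vanishes only if
`n = 2` or `m = 2`. It is applied to the dimensions of `U` and `U⊥`. -/
theorem geomSum_convex {q : ℕ} (hq : 2 ≤ q) {m n : ℕ} (hm : 2 ≤ m) (hn : 2 ≤ n) :
    geomSum q m + geomSum q n ≤ geomSum q 2 + geomSum q (m + n - 2) ∧
      (geomSum q m + geomSum q n = geomSum q 2 + geomSum q (m + n - 2) → m = 2 ∨ n = 2) := by
  obtain ⟨a, rfl⟩ := Nat.exists_eq_add_of_le hm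
  obtain ⟨b, rfl⟩ := Nat.exists_eq_add_of_le hn
  have e : 2 + a + (2 + b) - 2 = 2 + b + a := by omega
  rw [e, geomSum_add q (2 + b) a, geomSum_add q 2 a]
  have hle : q ^ 2 ≤ q ^ (2 + b) := Nat.pow_le_pow_right (by omega) (by omega)
  refine ⟨by nlinarith [Nat.mul_le_mul_right (geomSum q a) hle], fun h => ?_⟩
  by_contra! hne
  have ha : 0 < geomSum q a := by
    have h1 := geomSum_mono q (show 1 ≤ a by omega)
    simp only [geomSum, Finset.sum_range_one, pow_zero] at h1 ⊢
    omega
  have hlt : q ^ 2 < q ^ (2 + b) := Nat.pow_lt_pow_right (by omega) (by omega)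
  have := Nat.mul_lt_mul_of_pos_right hlt ha
  omega

end GeomSum

/-! ### The symplectic form, orthogonal complements and point sets of subspaces. -/

section Symplectic

variable (F : Type*) [Field F] (r : ℕ)

/-- `form` as a bilinear form. -/
def formBilin : LinearMap.BilinForm F (Fin 2 × Fin r → F) :=
  Matrix.toBilin' (formMatrix F r)

variable {F r}

@[simp]
theorem formBilin_apply (x y : Fin 2 × Fin r → F) : formBilin F r x y = form x y :=
  Matrix.toBilin'_apply' _ _ _

theorem formBilin_isRefl : (formBilin F r).IsRefl := fun x y h => by
  rw [formBilin_apply] at h ⊢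
  rw [form_swap, h, neg_zero]

theorem eq_zero_of_form_eq_zero {x : Fin 2 × Fin r → F} (h : ∀ y, form x y = 0) : x = 0 := by
  funext ⟨i, j⟩
  fin_cases i
  · simpa [form_eq_sum, Pi.single_apply] using h (Pi.single (1, j) 1)
  · simpa [form_eq_sum, Pi.single_apply] using h (Pi.single (0, j) 1)

theorem formBilin_nondegenerate : (formBilin F r).Nondegenerate :=
  ⟨fun x h => eq_zero_of_form_eq_zero fun y => by simpa using h y,
    fun x h => eq_zero_of_form_eq_zero fun y => by
      rw [form_swap]
      simpa using h y⟩

theorem finrank_space : Module.finrank F (Fin 2 × Fin r → F) = 2 * r := by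
  simp

/-- The orthogonal complement of a subspace with respect to the symplectic form. -/
abbrev perp (U : Submodule F (Fin 2 × Fin r → F)) : Submodule F (Fin 2 × Fin r → F) :=
  (formBilin F r).orthogonal U

theorem mem_perp {U : Submodule F (Fin 2 × Fin r → F)} {x : Fin 2 × Fin r → F} :
    x ∈ perp U ↔ ∀ u ∈ U, form u x = 0 := by
  simp [perp, LinearMap.BilinForm.mem_orthogonal_iff]

theorem mem_perp_span {s : Set (Fin 2 × Fin r → F)} {x : Fin 2 × Fin r → F} :
    x ∈ perp (Submodule.span F s) ↔ ∀ u ∈ s, form u x = 0 := by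
  rw [mem_perp]
  refine ⟨fun h u hu => h u (Submodule.subset_span hu), fun h u hu => ?_⟩
  have hle : Submodule.span F s ≤ LinearMap.ker ((formBilin F r).flip x) :=
    Submodule.span_le.mpr fun u hu => by simpa using h u hu
  simpa using hle hu

theorem finrank_perp (U : Submodule F (Fin 2 × Fin r → F)) :
    Module.finrank F (perp U) = 2 * r - Module.finrank F U := by
  rw [perp, LinearMap.BilinForm.finrank_orthogonal formBilin_nondegenerate, finrank_space]

theorem perp_perp (U : Submodule F (Fin 2 × Fin r → F)) : perp (perp U) = U :=
  LinearMap.BilinForm.orthogonal_orthogonal formBilin_nondegenerate formBilin_isRefl U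

theorem exists_form_eq_one (hr : 1 ≤ r) : ∃ u v : Fin 2 × Fin r → F, form u v = 1 :=
  ⟨Pi.single (1, ⟨0, hr⟩) 1, Pi.single (0, ⟨0, hr⟩) 1, by simp [form_eq_sum, Pi.single_apply]⟩

theorem ne_zero_of_form_ne_zero {u v : Fin 2 × Fin r → F} (h : form u v ≠ 0) : u ≠ 0 := by
  rintro rfl
  exact h (by simp [form_eq_sum])

theorem linearIndependent_of_form_ne_zero {u v : Fin 2 × Fin r → F} (h : form u v ≠ 0) :
    LinearIndependent F ![u, v] := by
  rw [LinearIndependent.pair_iff' (ne_zero_of_form_ne_zero h)]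
  rintro a rfl
  apply h
  have := form_smul_smul 1 a u u
  simpa [form_self] using this

theorem finrank_span_pair {u v : Fin 2 × Fin r → F} (h : LinearIndependent F ![u, v]) :
    Module.finrank F (Submodule.span F {u, v}) = 2 := by
  have := finrank_span_eq_card h
  rwa [Matrix.range_cons_cons_empty, Fintype.card_fin] at this

/-- Pairing `a • u + b • v` with `u` isolates `b`, and with `v` isolates `a`, because the form is
alternating. -/
theorem disjoint_perp_span_pair {u v : Fin 2 × Fin r → F} (h : form u v ≠ 0) :
    Disjoint (Submodule.span F {u, v}) (perp (Submodule.span F {u, v})) := by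
  rw [Submodule.disjoint_def]
  intro x hx hx'
  obtain ⟨a, b, rfl⟩ := Submodule.mem_span_pair.mp hx
  rw [mem_perp_span] at hx'
  have h1 := hx' u (by simp)
  have h2 := hx' v (by simp)
  simp only [← formBilin_apply, map_add, map_smul, smul_eq_mul] at h h1 h2
  have hv : formBilin F r v u ≠ 0 := by
    rw [formBilin_apply] at h ⊢
    rwa [form_swap, neg_ne_zero]
  simp only [formBilin_apply, form_self] at h h1 h2 hv
  have hb : b = 0 := by simpa [h] using h1
  have ha : a = 0 := by simpa [hv] using h2
  simp [ha, hb]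

/-- A nonzero vector of a nondegenerate subspace is not orthogonal to that whole subspace. -/
theorem exists_form_ne_zero {U : Submodule F (Fin 2 × Fin r → F)} (hU : Disjoint U (perp U))
    {x : Fin 2 × Fin r → F} (hx : x ∈ U) (hx0 : x ≠ 0) : ∃ y ∈ U, form x y ≠ 0 := by
  by_contra! h
  refine hx0 (Submodule.disjoint_def.mp hU x hx (mem_perp.mpr fun u hu => ?_))
  rw [form_swap, h u hu, neg_zero]

/-- The vertices contained in a subspace. -/
def points (U : Submodule F (Fin 2 × Fin r → F)) : Set (Vertex F r) := {p | p.rep ∈ U}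

theorem mem_points {U : Submodule F (Fin 2 × Fin r → F)} {p : Vertex F r} :
    p ∈ points U ↔ p.rep ∈ U := Iff.rfl

@[simp]
theorem mk_mem_points {U : Submodule F (Fin 2 × Fin r → F)} {x : Fin 2 × Fin r → F}
    (hx : x ≠ 0) : Projectivization.mk F x hx ∈ points U ↔ x ∈ U := by
  obtain ⟨a, ha⟩ := Projectivization.exists_smul_eq_mk_rep F x hx
  rw [mem_points, ← ha, Units.smul_def, U.smul_mem_iff a.ne_zero]

theorem disjoint_points {U W : Submodule F (Fin 2 × Fin r → F)} (h : Disjoint U W) :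
    Disjoint (points U) (points W) :=
  Set.disjoint_left.mpr fun p hU hW => p.rep_nonzero (Submodule.disjoint_def.mp h _ hU hW)

/-- The inclusion of `U` induces an injection of its projectivization with image `points U`. -/
theorem ncard_points [Fintype F] (U : Submodule F (Fin 2 × Fin r → F)) :
    (points U).ncard = geomSum (Fintype.card F) (Module.finrank F U) := by
  have hinj := Projectivization.map_injective U.subtype U.injective_subtype
  have hrange : points U = Set.range (Projectivization.map U.subtype U.injective_subtype) := by
    ext p
    constructor
    · intro hp
      refine ⟨Projectivization.mk F ⟨p.rep, hp⟩ fun h => p.rep_nonzero (congrArg Subtype.val h), ?_⟩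
      rw [Projectivization.map_mk]
      exact p.mk_rep
    · rintro ⟨p, rfl⟩
      induction p using Projectivization.ind with
      | h x hx => rw [Projectivization.map_mk, mk_mem_points]; exact x.2
  rw [hrange, ← Set.image_univ, Set.ncard_image_of_injective _ hinj, Set.ncard_univ,
    Projectivization.card_of_finrank F U rfl, Nat.card_eq_fintype_card, geomSum]

theorem adj_iff {p p' : Vertex F r} :
    (symplecticGraph F r).Adj p p' ↔ form p.rep p'.rep ≠ 0 := Iff.rfl

theorem neighborhood_points (U : Submodule F (Fin 2 × Fin r → F)) :
    neighborhood (symplecticGraph F r) (points U) = (points U ∪ points (perp U))ᶜ := by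
  ext p
  simp only [neighborhood, Set.mem_ofPred_eq, Set.mem_compl_iff, Set.mem_union, not_or,
    mem_points, mem_perp, not_forall, adj_iff]
  refine and_congr_right fun _ => ⟨?_, ?_⟩
  · rintro ⟨x, hx, h⟩
    exact ⟨x.rep, hx, h⟩
  · rintro ⟨u, hu, h⟩
    have hu0 := ne_zero_of_form_ne_zero h
    refine ⟨Projectivization.mk F u hu0, (mk_mem_points hu0).mpr hu, ?_⟩
    rw [← adj_iff, ← p.mk_rep, symplecticGraph_adj_mk]
    exact h

theorem hyperbolicLine_eq_points {u v : Fin 2 × Fin r → F} (hu : u ≠ 0) (hv : v ≠ 0) :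
    hyperbolicLine u v hu hv = points (Submodule.span F {u, v}) := by
  ext p
  induction p using Projectivization.ind with
  | h w hw =>
    rw [mk_mem_points, Submodule.mem_span_pair]
    simp only [hyperbolicLine, Set.mem_union, Set.mem_insert_iff, Set.mem_singleton_iff,
      Set.mem_ofPred_eq, Projectivization.mk_eq_mk_iff']
    constructor
    · rintro ((⟨a, rfl⟩ | ⟨a, rfl⟩) | ⟨x, _, _, a, rfl⟩)
      · exact ⟨a, 0, by simp⟩
      · exact ⟨0, a, by simp⟩
      · exact ⟨a, a * x, by rw [smul_add, mul_smul]⟩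
    · rintro ⟨a, b, rfl⟩
      by_cases ha : a = 0
      · exact Or.inl (Or.inr ⟨b, by simp [ha]⟩)
      by_cases hb : b = 0
      · exact Or.inl (Or.inl ⟨a, by simp [hb]⟩)
      -- Scaling the coefficient of `u` to 1 gives the representative used in `hyperbolicLine`.
      have e : a • (u + (a⁻¹ * b) • v) = a • u + b • v := by
        rw [smul_add, smul_smul, mul_inv_cancel_left₀ ha]
      refine Or.inr ⟨a⁻¹ * b, mul_ne_zero (inv_ne_zero ha) hb, fun h => hw ?_, a, e⟩
      rw [← e, h, smul_zero]

theorem setOf_adj (p : Vertex F r) :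
    {p' | (symplecticGraph F r).Adj p p'} = (points (perp (Submodule.span F {p.rep})))ᶜ := by
  ext p'
  rw [Set.mem_compl_iff, mem_points, mem_perp_span]
  simp [adj_iff]

theorem points_inf (U W : Submodule F (Fin 2 × Fin r → F)) :
    points (U ⊓ W) = points U ∩ points W := rfl

theorem perp_span_pair (u v : Fin 2 × Fin r → F) :
    perp (Submodule.span F {u, v}) =
      perp (Submodule.span F {u}) ⊓ perp (Submodule.span F {v}) := by
  ext x
  simp only [Submodule.mem_inf, mem_perp_span]
  simp

end Symplectic

/-! ### Strong regularity and connectedness. -/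

section Counting

variable {F : Type*} [Field F] [Fintype F] {r : ℕ}

theorem natCard_vertex : Nat.card (Vertex F r) = geomSum (Fintype.card F) (2 * r) := by
  rw [Projectivization.card_of_finrank F _ finrank_space, Nat.card_eq_fintype_card, geomSum]

theorem ncard_add_ncard_compl_vertex (A : Set (Vertex F r)) :
    A.ncard + Aᶜ.ncard = geomSum (Fintype.card F) (2 * r) := by
  rw [Set.ncard_add_ncard_compl, natCard_vertex]

/-- Peeling off the top powers makes the later counts linear in `q ^ (2 * r - 1)` and `q ^ (2 * r -
2)`, within reach of `omega`. -/
theorem geomSum_two_mul (q : ℕ) (hr : 1 ≤ r) :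
    geomSum q (2 * r) = geomSum q (2 * r - 2) + q ^ (2 * r - 2) + q ^ (2 * r - 1) ∧
      geomSum q (2 * r - 1) = geomSum q (2 * r - 2) + q ^ (2 * r - 2) := by
  obtain ⟨s, rfl⟩ := Nat.exists_eq_add_of_le' hr
  have e0 : 2 * (s + 1) = 2 * s + 1 + 1 := by ring
  have e1 : 2 * (s + 1) - 1 = 2 * s + 1 := by omega
  have e2 : 2 * (s + 1) - 2 = 2 * s := by omega
  rw [e1, e2, e0, geomSum_succ, geomSum_succ]
  exact ⟨rfl, rfl⟩

theorem pow_two_mul_sub_one (q : ℕ) (hr : 1 ≤ r) :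
    q ^ (2 * r - 1) = q ^ (2 * r - 2) * q := by
  rw [← pow_succ]
  congr 1
  omega

theorem ncard_neighborSet (hr : 1 ≤ r) (p : Vertex F r) :
    ((symplecticGraph F r).neighborSet p).ncard = Fintype.card F ^ (2 * r - 1) := by
  have h := ncard_add_ncard_compl_vertex (points (perp (Submodule.span F {p.rep})))
  have hs := geomSum_two_mul (Fintype.card F) hr
  rw [ncard_points, finrank_perp, finrank_span_singleton p.rep_nonzero] at h
  change {p' | (symplecticGraph F r).Adj p p'}.ncard = _
  rw [setOf_adj]
  omega

/-- Inclusion-exclusion on two distinct hyperplanes, which meet in codimension 2 whether or not the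
vertices are adjacent; hence `λ = μ`. -/
theorem ncard_commonNeighbors (hr : 1 ≤ r) {p p' : Vertex F r} (hp : p ≠ p') :
    ((symplecticGraph F r).commonNeighbors p p').ncard =
      Fintype.card F ^ (2 * r - 2) * (Fintype.card F - 1) := by
  have hs := geomSum_two_mul (Fintype.card F) hr
  have hpow := pow_two_mul_sub_one (Fintype.card F) hr
  have hcompl := ncard_add_ncard_compl_vertex
    (points (perp (Submodule.span F {p.rep})) ∪ points (perp (Submodule.span F {p'.rep})))
  have hunion := Set.ncard_union_add_ncard_inter
    (points (perp (Submodule.span F {p.rep}))) (points (perp (Submodule.span F {p'.rep})))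
  rw [← points_inf, ← perp_span_pair, ncard_points, ncard_points, ncard_points, finrank_perp,
    finrank_perp, finrank_perp, finrank_span_singleton p.rep_nonzero,
    finrank_span_singleton p'.rep_nonzero,
    finrank_span_pair (Projectivization.linearIndependent_pair_iff_ne.mpr hp)] at hunion
  rw [Set.compl_union, ← setOf_adj, ← setOf_adj] at hcompl
  change _ + ((symplecticGraph F r).commonNeighbors p p').ncard = _ at hcompl
  rw [Nat.mul_sub, mul_one, ← hpow]
  omega

theorem symplecticGraph_isSRGWith (hr : 1 ≤ r) :
    (symplecticGraph F r).IsSRGWith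
      ((Fintype.card F ^ (2 * r) - 1) / (Fintype.card F - 1)) (Fintype.card F ^ (2 * r - 1))
      (Fintype.card F ^ (2 * r - 2) * (Fintype.card F - 1))
      (Fintype.card F ^ (2 * r - 2) * (Fintype.card F - 1)) where
  card := by
    rw [← geomSum_eq_div Fintype.one_lt_card, Fintype.card_eq_nat_card, natCard_vertex]
  regular p := by
    rw [← ncard_neighborSet hr p, ← SimpleGraph.card_neighborSet_eq_degree,
      Fintype.card_eq_nat_card, Nat.card_coe_set_eq]
  of_adj p p' h := by
    rw [Fintype.card_eq_nat_card, Nat.card_coe_set_eq, ncard_commonNeighbors hr h.ne]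
  of_not_adj p p' hp _ := by
    rw [Fintype.card_eq_nat_card, Nat.card_coe_set_eq, ncard_commonNeighbors hr hp]

theorem symplecticGraph_connected (hr : 1 ≤ r) : (symplecticGraph F r).Connected := by
  have hq : 2 ≤ Fintype.card F := Fintype.one_lt_card
  have hne : Nonempty (Vertex F r) := by
    obtain ⟨u, v, h⟩ := exists_form_eq_one (F := F) hr
    exact ⟨Projectivization.mk F u (ne_zero_of_form_ne_zero (h ▸ one_ne_zero))⟩
  refine ⟨fun p p' => ?_⟩
  by_cases hp : p = p'
  · exact hp ▸ SimpleGraph.Reachable.refl p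
  have hpos : 0 < ((symplecticGraph F r).commonNeighbors p p').ncard := by
    rw [ncard_commonNeighbors hr hp]
    exact Nat.mul_pos (by positivity) (by omega)
  obtain ⟨w, hw, hw'⟩ := (Set.ncard_pos).mp hpos
  exact (SimpleGraph.Adj.reachable hw).trans (SimpleGraph.Adj.reachable hw').symm

end Counting

/-! ### Separations of the graph and orthogonal pairs of subspaces. -/

section Separation

variable {F : Type*} [Field F] {r : ℕ}

theorem two_le_finrank_of_adj {U : Submodule F (Fin 2 × Fin r → F)} {p p' : Vertex F r}
    (hp : p ∈ points U) (hp' : p' ∈ points U) (h : (symplecticGraph F r).Adj p p') :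
    2 ≤ Module.finrank F U := by
  refine (finrank_span_pair (linearIndependent_of_form_ne_zero h)).ge.trans
    (Submodule.finrank_mono (Submodule.span_le.mpr ?_))
  rintro _ (rfl | rfl)
  exacts [hp, hp']

/-- Two sets of vertices with no edges between them lie in mutually orthogonal subspaces. -/
theorem exists_subset_points_perp {A B : Set (Vertex F r)}
    (hAB : ∀ x ∈ A, ∀ y ∈ B, ¬ (symplecticGraph F r).Adj x y) :
    ∃ U : Submodule F (Fin 2 × Fin r → F), A ⊆ points U ∧ B ⊆ points (perp U) := by
  refine ⟨Submodule.span F (Projectivization.rep '' A),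
    fun a ha => Submodule.subset_span ⟨a, ha, rfl⟩, fun b hb => mem_perp_span.mpr ?_⟩
  rintro _ ⟨a, ha, rfl⟩
  simpa [adj_iff] using hAB a ha b hb

/-- The complement of a hyperbolic line and its orthogonal complement is the neighbourhood of that
hyperbolic line. -/
theorem exists_eq_neighborhood_hyperbolicLine {U : Submodule F (Fin 2 × Fin r → F)}
    (hU : Module.finrank F U = 2) {p p' : Vertex F r} (hp : p ∈ points U) (hp' : p' ∈ points U)
    (h : (symplecticGraph F r).Adj p p') :
    ∃ (u v : Fin 2 × Fin r → F) (hu : u ≠ 0) (hv : v ≠ 0),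
      (symplecticGraph F r).Adj (Projectivization.mk F u hu) (Projectivization.mk F v hv) ∧
      (points U ∪ points (perp U))ᶜ =
        neighborhood (symplecticGraph F r) (hyperbolicLine u v hu hv) := by
  refine ⟨p.rep, p'.rep, p.rep_nonzero, p'.rep_nonzero, ?_, ?_⟩
  · rw [p.mk_rep, p'.mk_rep]
    exact h
  · have hspan : Submodule.span F {p.rep, p'.rep} = U := by
      refine Submodule.eq_of_le_of_finrank_eq (Submodule.span_le.mpr ?_) ?_
      · rintro _ (rfl | rfl)
        exacts [hp, hp']
      · rw [hU, finrank_span_pair (linearIndependent_of_form_ne_zero h)]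
    rw [hyperbolicLine_eq_points, hspan, neighborhood_points]

theorem exists_adj_mem_points {U : Submodule F (Fin 2 × Fin r → F)} (hU : Disjoint U (perp U))
    {p : Vertex F r} (hp : p ∈ points U) : ∃ p' ∈ points U, (symplecticGraph F r).Adj p p' := by
  obtain ⟨y, hy, h⟩ := exists_form_ne_zero hU hp p.rep_nonzero
  have hy0 : y ≠ 0 := by
    rintro rfl
    exact h (by simp [form_eq_sum])
  refine ⟨Projectivization.mk F y hy0, (mk_mem_points hy0).mpr hy, ?_⟩
  rw [← p.mk_rep, symplecticGraph_adj_mk]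
  exact h

theorem nonempty_points {U : Submodule F (Fin 2 × Fin r → F)} (hU : 0 < Module.finrank F U) :
    (points U).Nonempty := by
  obtain ⟨x, hx, hx0⟩ := U.exists_mem_ne_zero_of_ne_bot fun h => by
    rw [h, finrank_bot] at hU
    exact hU.false
  exact ⟨Projectivization.mk F x hx0, (mk_mem_points hx0).mpr hx⟩

theorem isNonsingletonDisconnecting_neighborhood_points (hr : 2 ≤ r)
    {U : Submodule F (Fin 2 × Fin r → F)} (hU : Module.finrank F U = 2)
    (hdisj : Disjoint U (perp U)) :
    IsNonsingletonDisconnecting (symplecticGraph F r)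
      (neighborhood (symplecticGraph F r) (points U)) := by
  have hdisj' : Disjoint (perp U) (perp (perp U)) := by
    rw [perp_perp]
    exact hdisj.symm
  rw [isNonsingletonDisconnecting_iff, neighborhood_points]
  refine ⟨fun x hx => ?_, points U, points (perp U), (compl_compl _).symm, disjoint_points hdisj,
    nonempty_points (by omega), nonempty_points (by rw [finrank_perp]; omega), ?_⟩
  · rcases not_not.mp hx with hx | hx
    · obtain ⟨y, hy, h⟩ := exists_adj_mem_points hdisj hx
      exact ⟨y, not_not.mpr (Or.inl hy), h⟩
    · obtain ⟨y, hy, h⟩ := exists_adj_mem_points hdisj' hx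
      exact ⟨y, not_not.mpr (Or.inr hy), h⟩
  · intro x hx y hy h
    exact h (mem_perp.mp hy _ hx)

end Separation

/-! ### The value of `κ₂` and the extremal sets. -/

section Kappa

variable {F : Type*} [Field F] [Fintype F] {r : ℕ}

theorem ncard_compl_points_union (hr : 2 ≤ r) {U : Submodule F (Fin 2 × Fin r → F)}
    (hU : Module.finrank F U = 2) (hdisj : Disjoint U (perp U)) :
    (points U ∪ points (perp U))ᶜ.ncard =
      Fintype.card F ^ (2 * r - 1) + Fintype.card F ^ (2 * r - 2) - Fintype.card F - 1 := by
  have h := ncard_add_ncard_compl_vertex (points U ∪ points (perp U))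
  rw [Set.ncard_union_eq (disjoint_points hdisj), ncard_points, ncard_points, finrank_perp, hU] at h
  have hs := geomSum_two_mul (Fintype.card F) (r := r) (by omega)
  have h2 : geomSum (Fintype.card F) 2 = 1 + Fintype.card F := by
    simp [geomSum, Finset.sum_range_succ]
  omega

theorem neighborhood_hyperbolicLine_spec (hr : 2 ≤ r) {u v : Fin 2 × Fin r → F} (hu : u ≠ 0)
    (hv : v ≠ 0) (h : form u v ≠ 0) :
    IsNonsingletonDisconnecting (symplecticGraph F r)
        (neighborhood (symplecticGraph F r) (hyperbolicLine u v hu hv)) ∧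
      (neighborhood (symplecticGraph F r) (hyperbolicLine u v hu hv)).ncard =
        Fintype.card F ^ (2 * r - 1) + Fintype.card F ^ (2 * r - 2) - Fintype.card F - 1 := by
  have hrank := finrank_span_pair (linearIndependent_of_form_ne_zero h)
  have hdisj := disjoint_perp_span_pair h
  rw [hyperbolicLine_eq_points]
  refine ⟨isNonsingletonDisconnecting_neighborhood_points hr hrank hdisj, ?_⟩
  rw [neighborhood_points, ncard_compl_points_union hr hrank hdisj]

/-- The lower bound for the size of a disconnecting set that leaves no singletons, with the
description of the case of equality. -/
theorem IsNonsingletonDisconnecting.le_ncard {S : Set (Vertex F r)}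
    (hS : IsNonsingletonDisconnecting (symplecticGraph F r) S) :
    Fintype.card F ^ (2 * r - 1) + Fintype.card F ^ (2 * r - 2) - Fintype.card F - 1 ≤ S.ncard ∧
      (S.ncard =
          Fintype.card F ^ (2 * r - 1) + Fintype.card F ^ (2 * r - 2) - Fintype.card F - 1 →
        ∃ (u v : Fin 2 × Fin r → F) (hu : u ≠ 0) (hv : v ≠ 0),
          (symplecticGraph F r).Adj (Projectivization.mk F u hu) (Projectivization.mk F v hv) ∧
          S = neighborhood (symplecticGraph F r) (hyperbolicLine u v hu hv)) := by
  obtain ⟨hiso, A, B, hAB, hdisj, ⟨a, ha⟩, ⟨b, hb⟩, hno⟩ := isNonsingletonDisconnecting_iff.mp hS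
  have hno' : ∀ x ∈ B, ∀ y ∈ A, ¬ (symplecticGraph F r).Adj x y :=
    fun x hx y hy h => hno y hy x hx h.symm
  obtain ⟨a', ha', haa'⟩ : ∃ a' ∈ A, (symplecticGraph F r).Adj a a' := by
    obtain ⟨y, hy, h⟩ := hiso a (hAB.le (Or.inl ha))
    exact ⟨y, (hAB.ge hy).resolve_right fun hy' => hno a ha y hy' h, h⟩
  obtain ⟨b', hb', hbb'⟩ : ∃ b' ∈ B, (symplecticGraph F r).Adj b b' := by
    obtain ⟨y, hy, h⟩ := hiso b (hAB.le (Or.inr hb))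
    exact ⟨y, (hAB.ge hy).resolve_left fun hy' => hno' b hb y hy' h, h⟩
  obtain ⟨U, hAU, hBU⟩ := exists_subset_points_perp hno
  have hm := two_le_finrank_of_adj (hAU ha) (hAU ha') haa'
  have hn := two_le_finrank_of_adj (hBU hb) (hBU hb') hbb'
  have hq : 2 ≤ Fintype.card F := Fintype.one_lt_card
  obtain ⟨hle, heq⟩ := geomSum_convex hq hm hn
  have hfin : Module.finrank F U + Module.finrank F (perp U) - 2 = 2 * r - 2 := by
    -- The bound `hn` ensures that `2 * r - finrank U` is not truncated.
    rw [finrank_perp] at hn ⊢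
    omega
  rw [hfin] at hle heq
  have hcA := Set.ncard_le_ncard hAU
  have hcB := Set.ncard_le_ncard hBU
  rw [ncard_points] at hcA hcB
  have hc := ncard_add_ncard_compl_vertex S
  rw [← hAB, Set.ncard_union_eq hdisj] at hc
  have hr : 1 ≤ r := by
    rw [finrank_perp] at hn
    omega
  have hs := geomSum_two_mul (Fintype.card F) hr
  have h2 : geomSum (Fintype.card F) 2 = 1 + Fintype.card F := by
    simp [geomSum, Finset.sum_range_succ]
  have hpow := pow_two_mul_sub_one (Fintype.card F) hr
  have hpos : 0 < Fintype.card F ^ (2 * r - 2) := by positivity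
  -- This makes the natural-number subtractions in the bound exact.
  have hbig : Fintype.card F + 1 ≤
      Fintype.card F ^ (2 * r - 1) + Fintype.card F ^ (2 * r - 2) := by
    rw [hpow]
    nlinarith
  refine ⟨by omega, fun hcard => ?_⟩
  -- At the minimum size, no slack remains in the convexity bound or in either inclusion.
  have hA : A = points U :=
    Set.eq_of_subset_of_ncard_le hAU (by rw [ncard_points]; omega)
  have hB : B = points (perp U) :=
    Set.eq_of_subset_of_ncard_le hBU (by rw [ncard_points]; omega)
  rw [← compl_compl S, ← hAB, hA, hB]
  rcases heq (by omega) with h | h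
  · exact exists_eq_neighborhood_hyperbolicLine h (hAU ha) (hAU ha') haa'
  -- If the plane is `U⊥`, the roles of `U` and `U⊥` are exchanged by double orthogonality.
  · have := exists_eq_neighborhood_hyperbolicLine h (hBU hb) (hBU hb') hbb'
    rwa [perp_perp, Set.union_comm] at this

theorem kappa2_symplecticGraph (hr : 2 ≤ r) :
    kappa2 (symplecticGraph F r) =
      ((Fintype.card F ^ (2 * r - 1) + Fintype.card F ^ (2 * r - 2) - Fintype.card F - 1 : ℕ) :
        ℕ∞) := by
  apply le_antisymm
  · obtain ⟨u, v, h⟩ := exists_form_eq_one (F := F) (r := r) (by omega)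
    have h0 : form u v ≠ 0 := h ▸ one_ne_zero
    have h0' : form v u ≠ 0 := by
      rwa [form_swap, neg_ne_zero]
    obtain ⟨hS, hcard⟩ := neighborhood_hyperbolicLine_spec hr (ne_zero_of_form_ne_zero h0)
      (ne_zero_of_form_ne_zero h0') h0
    refine (iInf₂_le _ hS).trans ?_
    rw [← hcard, Set.Finite.cast_ncard_eq (Set.toFinite _)]
  · refine le_iInf₂ fun S hS => ?_
    rw [← Set.Finite.cast_ncard_eq (Set.toFinite S)]
    exact_mod_cast (IsNonsingletonDisconnecting.le_ncard hS).1

theorem isNonsingletonDisconnecting_and_encard_eq_iff (hr : 2 ≤ r) (S : Set (Vertex F r)) :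
    (IsNonsingletonDisconnecting (symplecticGraph F r) S ∧
        S.encard = ((Fintype.card F ^ (2 * r - 1) + Fintype.card F ^ (2 * r - 2) -
          Fintype.card F - 1 : ℕ) : ℕ∞)) ↔
      ∃ (u v : Fin 2 × Fin r → F) (hu : u ≠ 0) (hv : v ≠ 0),
        (symplecticGraph F r).Adj (Projectivization.mk F u hu) (Projectivization.mk F v hv) ∧
        S = neighborhood (symplecticGraph F r) (hyperbolicLine u v hu hv) := by
  rw [← Set.Finite.cast_ncard_eq (Set.toFinite S), Nat.cast_inj]
  refine ⟨fun ⟨hS, hcard⟩ => hS.le_ncard.2 hcard, ?_⟩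
  rintro ⟨u, v, hu, hv, h, rfl⟩
  exact neighborhood_hyperbolicLine_spec hr hu hv ((symplecticGraph_adj_mk hu hv).mp h)

/-- The gap between `κ₂` and `2k - λ - 2`, free of truncated subtraction. -/
theorem kappa2_gap {q : ℕ} (hq : 2 ≤ q) (hr : 2 ≤ r) :
    q ^ (2 * r - 1) + q ^ (2 * r - 2) - q - 1 + (q - 1) + q ^ (2 * r - 2) * (q - 1) + 2 =
      2 * q ^ (2 * r - 1) := by
  have hpow := pow_two_mul_sub_one q (r := r) (by omega)
  have hpos : 0 < q ^ (2 * r - 2) := by positivity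
  have hle : q ^ (2 * r - 2) ≤ q ^ (2 * r - 1) := Nat.pow_le_pow_right (by omega) (by omega)
  have hbig : q + 1 ≤ q ^ (2 * r - 1) + q ^ (2 * r - 2) := by
    rw [hpow]
    nlinarith
  rw [Nat.mul_sub, mul_one, ← hpow]
  omega

end Kappa

end SymplecticSRG

theorem mainTheorem1 (r : ℕ) (hr : 2 ≤ r) :
    -- the assertions about `Sp(2r, q)` for each finite field `F` with `q` elements
    (∀ (F : Type*) [Field F] [Fintype F] (q : ℕ), Fintype.card F = q →
      -- `Sp(2r, q)` is a connected strongly regular graph, with these parameters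
      (SymplecticSRG.symplecticGraph F r).Connected ∧
      (SymplecticSRG.symplecticGraph F r).IsSRGWith
        ((q ^ (2 * r) - 1) / (q - 1)) (q ^ (2 * r - 1))
        (q ^ (2 * r - 2) * (q - 1)) (q ^ (2 * r - 2) * (q - 1)) ∧
      -- the value of `κ₂`
      SymplecticSRG.kappa2 (SymplecticSRG.symplecticGraph F r) =
        ((q ^ (2 * r - 1) + q ^ (2 * r - 2) - q - 1 : ℕ) : ℕ∞) ∧
      -- it is smaller than `2k - λ - 2` by `q - 1`
      SymplecticSRG.kappa2 (SymplecticSRG.symplecticGraph F r) + ((q - 1 : ℕ) : ℕ∞) =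
        ((2 * q ^ (2 * r - 1) - q ^ (2 * r - 2) * (q - 1) - 2 : ℕ) : ℕ∞) ∧
      -- the minimum sets are exactly the neighbourhoods of the hyperbolic lines
      (∀ S : Set (SymplecticSRG.Vertex F r),
        (SymplecticSRG.IsNonsingletonDisconnecting (SymplecticSRG.symplecticGraph F r) S ∧
          S.encard = ((q ^ (2 * r - 1) + q ^ (2 * r - 2) - q - 1 : ℕ) : ℕ∞)) ↔
        ∃ (u v : Fin 2 × Fin r → F) (hu : u ≠ 0) (hv : v ≠ 0),
          (SymplecticSRG.symplecticGraph F r).Adj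
            (Projectivization.mk F u hu) (Projectivization.mk F v hv) ∧
          S = SymplecticSRG.neighborhood (SymplecticSRG.symplecticGraph F r)
            (SymplecticSRG.hyperbolicLine u v hu hv))) ∧
    -- the gap `(2k - λ - 2) - κ₂` is unbounded over connected strongly regular graphs,
    -- already over the symplectic graphs `Sp(2r, p)` with `r` fixed and `p` prime
    (∀ N : ℕ, ∃ (p : ℕ) (_ : Fact p.Prime) (n k l m : ℕ),
      (SymplecticSRG.symplecticGraph (ZMod p) r).Connected ∧
      (SymplecticSRG.symplecticGraph (ZMod p) r).IsSRGWith n k l m ∧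
      SymplecticSRG.kappa2 (SymplecticSRG.symplecticGraph (ZMod p) r) + (N : ℕ∞) + (l : ℕ∞) + 2 ≤
        2 * (k : ℕ∞)) := by
  refine ⟨?_, fun N => ?_⟩
  · rintro F _ _ q rfl
    refine ⟨SymplecticSRG.symplecticGraph_connected (by omega),
      SymplecticSRG.symplecticGraph_isSRGWith (by omega),
      SymplecticSRG.kappa2_symplecticGraph hr, ?_,
      SymplecticSRG.isNonsingletonDisconnecting_and_encard_eq_iff hr⟩
    have h := SymplecticSRG.kappa2_gap (q := Fintype.card F) Fintype.one_lt_card hr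
    rw [SymplecticSRG.kappa2_symplecticGraph hr, ← Nat.cast_add, Nat.cast_inj]
    omega
  -- The gap for `Sp(2r, p)` is exactly `p - 1`, so `p ≥ N + 1` suffices.
  · obtain ⟨p, hpN, hp⟩ := Nat.exists_infinite_primes (N + 1)
    have : Fact p.Prime := ⟨hp⟩
    refine ⟨p, ⟨hp⟩, _, _, _, _, SymplecticSRG.symplecticGraph_connected (by omega),
      SymplecticSRG.symplecticGraph_isSRGWith (by omega), ?_⟩
    rw [SymplecticSRG.kappa2_symplecticGraph hr, ZMod.card]
    have h := SymplecticSRG.kappa2_gap hp.two_le hr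
    norm_cast
    omega
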